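/- **Theorem.** For an integer $n\ge 1$ let $$P_n(x)=\frac{1}{n!}\,\frac{d^n}{dx^n}\bigl(x(1-x)\bigr)^n .$$ Then the integral $$J_3(n)=-\int_{(0,1)^2}\frac{\log^3(xy)\,P_n(x)\,P_n(y)}{1-xy}\,dx\,dy$$ converges absolutely, and for every integer $n\ge 1$ $$\frac{6}{(n+1)^4}\;\le\; J_3(n)\;\le\;\frac{6\pi^2}{\left(n+\frac12\right)^2}.$$ -/

import Mathlib

open MeasureTheory

/-- The Legendre-type polynomial function `P_n(x) = (1/n!) dⁿ/dxⁿ (x(1-x))ⁿ` on `ℝ`. -/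
noncomputable def legendreP (n : ℕ) (x : ℝ) : ℝ :=
  (1 / (n.factorial : ℝ)) * iteratedDeriv n (fun t : ℝ => (t * (1 - t)) ^ n) x

/-- The open unit square `(0,1)²`. -/
def unitSquare : Set (ℝ × ℝ) := Set.Ioo (0 : ℝ) 1 ×ˢ Set.Ioo (0 : ℝ) 1

/-- The integrand `log³(xy) P_n(x) P_n(y) / (1 - xy)`. -/
noncomputable def integrandJ3 (n : ℕ) (p : ℝ × ℝ) : ℝ :=
  Real.log (p.1 * p.2) ^ 3 * legendreP n p.1 * legendreP n p.2 / (1 - p.1 * p.2)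

/-- `J₃(n) = -∫_{(0,1)²} log³(xy) P_n(x) P_n(y) / (1 - xy) dx dy`. -/
noncomputable def J3 (n : ℕ) : ℝ :=
  -∫ p in unitSquare, integrandJ3 n p ∂(volume : Measure (ℝ × ℝ))

/-! Write N = n(n+1) and S_m(k) = `legendreSum n m k`. Expanding 1/(1-xy) geometrically and log³(xy)
binomially splits the double integral into products of moments ∫ x^k log^i x P_n = (-1)^i i!
S_{i+1}(k), so J₃(n) = ∑_k 12 (S₁(k) S₄(k) + S₂(k) S₃(k)) (`hasSum_J3`).

The term k = 0 dominates. There S₁ = 0 by orthogonality, S₂ = 1/N exactly (`legendreSum_two_zero`),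
and 2N S₃ lies between 3 and 3n (`legendreSum_three_zero_bounds`); the term is thus between 18/N²
and 18n/N².

For k ≥ 1, the self-adjoint Legendre operator L f = (x(1-x) f')' satisfies L P_n = -N P_n. Hence N
times a moment of P_n is, up to sign, the pairing of P_n with L(x^k log^i x), which Cauchy-Schwarz
bounds using ‖P_n‖² = 1/(2n+1) (`legendreSum_sq_le_of_adjoint`). Each product of two moments gains
1/N², and the whole tail is at most 10/N² (`abs_J3_sub_le`), less than the 18/N² of the main term.
-/

/-! ### Coefficients of the shifted Legendre polynomial and their recurrences. -/

/-- The coefficient of `x ^ j` in the shifted Legendre polynomial of degree `n`. -/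
noncomputable def legendreCoeff (n j : ℕ) : ℝ :=
  (-1) ^ j * n.choose j * (n + j).choose n

/-- The sum `∑ⱼ cⱼ / (s + j + 1) ^ m` over the coefficients of the shifted Legendre polynomial. -/
noncomputable def legendreSum (n m : ℕ) (s : ℝ) : ℝ :=
  ∑ j ∈ Finset.range (n + 1), legendreCoeff n j / (s + j + 1) ^ m

lemma legendreCoeff_eq_coeff (n j : ℕ) :
    legendreCoeff n j = ((Polynomial.shiftedLegendre n).coeff j : ℝ) := by
  simp [legendreCoeff, Polynomial.coeff_shiftedLegendre]

lemma aeval_shiftedLegendre_eq_sum (n : ℕ) (x : ℝ) :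
    Polynomial.aeval x (Polynomial.shiftedLegendre n)
      = ∑ j ∈ Finset.range (n + 1), legendreCoeff n j * x ^ j := by
  rw [Polynomial.aeval_eq_sum_range, Polynomial.natDegree_shiftedLegendre]
  refine Finset.sum_congr rfl fun j _ => ?_
  rw [legendreCoeff_eq_coeff, zsmul_eq_mul]

lemma iterate_deriv_aeval (p : Polynomial ℝ) (n : ℕ) :
    deriv^[n] (fun x => p.eval x) = fun x => (Polynomial.derivative^[n] p).eval x := by
  induction n generalizing p with
  | zero => rfl
  | succ n ih =>
    rw [Function.iterate_succ_apply, Function.iterate_succ_apply, ← ih]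
    congr 1
    ext x
    exact p.deriv

lemma legendreP_eq_sum (n : ℕ) (x : ℝ) :
    legendreP n x = ∑ j ∈ Finset.range (n + 1), legendreCoeff n j * x ^ j := by
  rw [← aeval_shiftedLegendre_eq_sum, legendreP, iteratedDeriv_eq_iterate]
  have h1 : (fun t : ℝ => (t * (1 - t)) ^ n) = fun t =>
      (((Polynomial.X ^ n * (1 - Polynomial.X) ^ n : Polynomial ℤ).map
        (Int.castRingHom ℝ)).eval t) := by
    ext t
    simp [mul_pow]
  rw [h1, iterate_deriv_aeval, Polynomial.iterate_derivative_map,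
    ← Polynomial.factorial_mul_shiftedLegendre_eq]
  simp only [Polynomial.map_mul, Polynomial.eval_mul, Polynomial.map_natCast,
    Polynomial.eval_natCast]
  rw [Polynomial.aeval_def, Polynomial.eval_map]
  have : (n.factorial : ℝ) ≠ 0 := by positivity
  field_simp
  rfl

lemma legendreCoeff_zero_right (n : ℕ) : legendreCoeff n 0 = 1 := by
  simp [legendreCoeff]

lemma legendreCoeff_of_lt {n j : ℕ} (h : n < j) : legendreCoeff n j = 0 := by
  simp [legendreCoeff, Nat.choose_eq_zero_of_lt h]

lemma sum_legendreCoeff (n : ℕ) :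
    ∑ j ∈ Finset.range (n + 1), legendreCoeff n j = (-1) ^ n := by
  have h := Polynomial.shiftedLegendre_eval_symm n (1 : ℝ)
  rw [sub_self, aeval_shiftedLegendre_eq_sum, aeval_shiftedLegendre_eq_sum] at h
  simpa [Finset.sum_range_succ', legendreCoeff_zero_right] using h

/-- This is the coefficient of x^j in the Legendre equation (x(1-x)P')' + n(n+1)P = 0. -/
lemma legendreCoeff_succ_right (n j : ℕ) :
    legendreCoeff n (j + 1) * ((j : ℝ) + 1) ^ 2
      = ((j : ℝ) * (j + 1) - n * (n + 1)) * legendreCoeff n j := by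
  rcases lt_or_ge n j with h | h
  · rw [legendreCoeff_of_lt h, legendreCoeff_of_lt (by omega)]; simp
  have h1 : ((n.choose (j + 1) : ℕ) : ℝ) * (j + 1) = n.choose j * ((n : ℝ) - j) := by
    have := Nat.choose_succ_right_eq n j
    rw [← Nat.cast_sub h]
    exact_mod_cast this
  have h2 : (((n + (j + 1)).choose n : ℕ) : ℝ) * (j + 1) = (n + j).choose n * ((n : ℝ) + j + 1) := by
    have := Nat.choose_mul_succ_eq (n + j) n
    have e : n + j + 1 - n = j + 1 := by omega
    rw [e] at this
    rw [← add_assoc]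
    exact_mod_cast this.symm
  calc _ = (-1) ^ (j + 1) * (((n.choose (j + 1) : ℕ) : ℝ) * (j + 1))
        * ((((n + (j + 1)).choose n : ℕ) : ℝ) * (j + 1)) := by unfold legendreCoeff; ring
    _ = _ := by rw [h1, h2]; unfold legendreCoeff; ring

lemma legendreCoeff_succ_left (n j : ℕ) :
    legendreCoeff (n + 1) j * ((n : ℝ) + 1 - j) = legendreCoeff n j * (n + 1 + j) := by
  rcases lt_trichotomy (n + 1) j with h | h | h
  · rw [legendreCoeff_of_lt h, legendreCoeff_of_lt (by omega)]; simp
  · subst h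
    rw [legendreCoeff_of_lt (n := n) (by omega)]; simp
  have h1 : ((n.choose j : ℕ) : ℝ) * (n + 1) = (n + 1).choose j * ((n : ℝ) + 1 - j) := by
    have := Nat.choose_mul_succ_eq n j
    have e : ((n + 1 - j : ℕ) : ℝ) = (n : ℝ) + 1 - j := by
      rw [Nat.cast_sub h.le]; push_cast; ring
    rw [← e]
    exact_mod_cast this
  have h2 : (((n + 1 + j).choose (n + 1) : ℕ) : ℝ) * (n + 1)
      = (n + j).choose n * ((n : ℝ) + 1 + j) := by
    have := Nat.add_one_mul_choose_eq (n + j) n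
    have e : n + 1 + j = n + j + 1 := by omega
    rw [e]
    have := congrArg (Nat.cast : ℕ → ℝ) this
    push_cast at this ⊢
    linarith
  have h3 : (n : ℝ) + 1 ≠ 0 := by positivity
  apply mul_right_cancel₀ h3
  calc _ = (-1) ^ j * ((n + 1).choose j * ((n : ℝ) + 1 - j))
        * ((((n + 1 + j).choose (n + 1) : ℕ) : ℝ) * (n + 1)) := by unfold legendreCoeff; ring
    _ = _ := by rw [← h1, h2]; unfold legendreCoeff; ring

/-! ### Orthogonality to lower powers and the L² norm. -/

/-- The adjoint form of the Legendre differential equation on coefficient sequences. -/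
lemma sum_legendreCoeff_mul_adjoint (n : ℕ) (X : ℝ → ℝ) :
    ∑ j ∈ Finset.range (n + 1), legendreCoeff n j *
      ((j : ℝ) ^ 2 * X (j - 1) - j * (j + 1) * X j + n * (n + 1) * X j) = 0 := by
  have h : ∑ j ∈ Finset.range (n + 1), legendreCoeff n j * ((j : ℝ) ^ 2 * X (j - 1))
      = ∑ j ∈ Finset.range (n + 1), legendreCoeff n j * ((j * (j + 1) - n * (n + 1)) * X j) := by
    -- The extra term vanishes since c_{n+1} = 0, and the factor j² kills the term with X(-1);
    -- shifting the index then leaves j = 0, …, n on both sides.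
    have e : ∑ j ∈ Finset.range (n + 1), legendreCoeff n j * ((j : ℝ) ^ 2 * X (j - 1))
        = ∑ j ∈ Finset.range (n + 2), legendreCoeff n j * ((j : ℝ) ^ 2 * X (j - 1)) := by
      rw [Finset.sum_range_succ _ (n + 1), legendreCoeff_of_lt (Nat.lt_succ_self n)]; simp
    rw [e, Finset.sum_range_succ']
    simp only [Nat.cast_zero, ne_eq, OfNat.ofNat_ne_zero, not_false_eq_true, zero_pow, zero_mul,
      mul_zero, add_zero]
    refine Finset.sum_congr rfl fun j _ => ?_
    have := legendreCoeff_succ_right n j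
    push_cast
    rw [add_sub_cancel_right, ← mul_assoc, this]
    ring
  rw [← sub_eq_zero, ← Finset.sum_sub_distrib] at h
  rw [← h]
  refine Finset.sum_congr rfl fun j _ => ?_
  ring

lemma legendreSum_one_recurrence (n k : ℕ) :
    ((k : ℝ) * (k + 1) - n * (n + 1)) * legendreSum n 1 k = k ^ 2 * legendreSum n 1 (k - 1) := by
  have h := sum_legendreCoeff_mul_adjoint n (fun x => 1 / (k + x + 1))
  unfold legendreSum
  rw [← sub_eq_zero, Finset.mul_sum, Finset.mul_sum, ← Finset.sum_sub_distrib,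
    ← neg_eq_zero, ← Finset.sum_neg_distrib, ← h]
  refine Finset.sum_congr rfl fun j _ => ?_
  have h1 : (k : ℝ) + j + 1 ≠ 0 := by positivity
  have e1 : (k : ℝ) - 1 + j + 1 = k + j := by ring
  have e2 : (k : ℝ) + (j - 1) + 1 = k + j := by ring
  simp only [e1, e2, pow_one]
  -- For k = j = 0 the reciprocal 1/(k+j) takes the value 1/0 = 0, and its coefficients k² and j²
  -- vanish anyway.
  rcases eq_or_ne ((k : ℝ) + j) 0 with h2 | h2
  · have hk : (k : ℝ) = 0 := by
      have := Nat.cast_nonneg (α := ℝ) k; have := Nat.cast_nonneg (α := ℝ) j; linarith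
    have hj : (j : ℝ) = 0 := by linarith
    simp only [hk, hj]
    ring
  · field_simp
    ring

/-- Orthogonality of P_n to x^k. In the recurrence the left factor is nonzero for k < n, and the
right side vanishes at k = 0, so zeros propagate upwards. -/
lemma legendreSum_one_eq_zero {n k : ℕ} (h : k < n) : legendreSum n 1 k = 0 := by
  have key : ∀ k : ℕ, k < n → ((k : ℝ) * (k + 1) - n * (n + 1)) ≠ 0 := by
    intro k hk
    have : (k : ℝ) < n := by exact_mod_cast hk
    have : (0 : ℝ) ≤ k := by positivity
    nlinarith
  induction k with
  | zero =>
    have := legendreSum_one_recurrence n 0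
    have h0 := key 0 h
    have h1 : (((0 : ℕ) : ℝ) * ((0 : ℕ) + 1) - n * (n + 1)) * legendreSum n 1 (0 : ℕ) = 0 := by
      rw [this]; simp
    exact (mul_eq_zero.mp h1).resolve_left h0
  | succ k ih =>
    have := legendreSum_one_recurrence n (k + 1)
    have h0 := key (k + 1) h
    have ih := ih (by omega)
    push_cast at this h0 ⊢
    rw [add_sub_cancel_right, ih, mul_zero] at this
    exact (mul_eq_zero.mp this).resolve_left h0

/-- The double sum is A = ∫ P_n². Weighting its terms by i + j + 1 cancels the denominators and
leaves P_n(1)² = 1. By orthogonality only i = n survives the weight i, which therefore acts as n;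
likewise for j. Hence (2n+1) A = 1. -/
lemma sum_sum_legendreCoeff_div (n : ℕ) :
    ∑ i ∈ Finset.range (n + 1), ∑ j ∈ Finset.range (n + 1),
      legendreCoeff n i * legendreCoeff n j / ((i : ℝ) + j + 1) = 1 / (2 * n + 1) := by
  set A := ∑ i ∈ Finset.range (n + 1), ∑ j ∈ Finset.range (n + 1),
      legendreCoeff n i * legendreCoeff n j / ((i : ℝ) + j + 1) with hA
  have hA1 : A = ∑ i ∈ Finset.range (n + 1), legendreCoeff n i * legendreSum n 1 i := by
    rw [hA]
    refine Finset.sum_congr rfl fun i _ => ?_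
    rw [legendreSum, Finset.mul_sum]
    refine Finset.sum_congr rfl fun j _ => ?_
    rw [pow_one]; ring
  have hB : ∑ i ∈ Finset.range (n + 1), (i : ℝ) * (legendreCoeff n i * legendreSum n 1 i)
      = n * A := by
    rw [hA1, Finset.mul_sum]
    refine Finset.sum_congr rfl fun i hi => ?_
    rcases eq_or_ne i n with rfl | h
    · rfl
    · rw [legendreSum_one_eq_zero (lt_of_le_of_ne (by simpa [Nat.lt_succ_iff] using hi) h)]; simp
  have hB1 : ∑ i ∈ Finset.range (n + 1), ∑ j ∈ Finset.range (n + 1),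
      (i : ℝ) * (legendreCoeff n i * legendreCoeff n j / ((i : ℝ) + j + 1)) = n * A := by
    rw [← hB]
    refine Finset.sum_congr rfl fun i _ => ?_
    rw [legendreSum, Finset.mul_sum, Finset.mul_sum]
    refine Finset.sum_congr rfl fun j _ => ?_
    rw [pow_one]; ring
  have hB2 : ∑ i ∈ Finset.range (n + 1), ∑ j ∈ Finset.range (n + 1),
      (j : ℝ) * (legendreCoeff n i * legendreCoeff n j / ((i : ℝ) + j + 1)) = n * A := by
    rw [← hB1, Finset.sum_comm]
    refine Finset.sum_congr rfl fun i _ => Finset.sum_congr rfl fun j _ => ?_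
    rw [add_comm (i : ℝ) j]; ring
  have hC : A + n * A + n * A = 1 := by
    have : (∑ i ∈ Finset.range (n + 1), legendreCoeff n i)
        * (∑ j ∈ Finset.range (n + 1), legendreCoeff n j) = 1 := by
      rw [sum_legendreCoeff, ← mul_pow]; simp
    rw [← this, Finset.sum_mul_sum]
    nth_rewrite 2 [← hB1]
    rw [← hB2, hA, ← Finset.sum_add_distrib, ← Finset.sum_add_distrib]
    refine Finset.sum_congr rfl fun i _ => ?_
    rw [← Finset.sum_add_distrib, ← Finset.sum_add_distrib]
    refine Finset.sum_congr rfl fun j _ => ?_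
    have h1 : (i : ℝ) + j + 1 ≠ 0 := by positivity
    field_simp
    ring
  have h1 : 2 * (n : ℝ) + 1 ≠ 0 := by positivity
  field_simp
  linarith

/-! ### The moments at k = 0. -/

/-- Divide `legendreCoeff_succ_left` by (j+1)^(m+1), writing n+1-j = (n+2)-(j+1) and n+1+j =
n+(j+1). -/
lemma legendreSum_succ_left (n m : ℕ) :
    ((n : ℝ) + 2) * legendreSum (n + 1) (m + 1) 0
      = legendreSum (n + 1) m 0 + legendreSum n m 0 + n * legendreSum n (m + 1) 0 := by
  have e : ∀ r, legendreSum n r 0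
      = ∑ j ∈ Finset.range (n + 2), legendreCoeff n j / ((0 : ℝ) + j + 1) ^ r := by
    intro r
    rw [Finset.sum_range_succ _ (n + 1), legendreCoeff_of_lt (Nat.lt_succ_self n), legendreSum]
    simp
  rw [e, e, legendreSum, legendreSum, Finset.mul_sum, Finset.mul_sum, ← Finset.sum_add_distrib,
    ← Finset.sum_add_distrib]
  refine Finset.sum_congr rfl fun j _ => ?_
  have h := legendreCoeff_succ_left n j
  have h1 : (0 : ℝ) + j + 1 ≠ 0 := by positivity
  rw [pow_succ]
  have h2 : ((0 : ℝ) + j + 1) ^ m ≠ 0 := pow_ne_zero _ h1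
  field_simp
  linarith

lemma legendreSum_two_zero (n : ℕ) (hn : 1 ≤ n) : legendreSum n 2 0 = 1 / (n * (n + 1)) := by
  induction n, hn using Nat.le_induction with
  | base =>
    norm_num [legendreSum, Finset.sum_range_succ, legendreCoeff]
  | succ n hn ih =>
    have h := legendreSum_succ_left n 1
    have h1 : legendreSum (n + 1) 1 0 = 0 := by
      simpa using legendreSum_one_eq_zero (n := n + 1) (k := 0) (by omega)
    have h2 : legendreSum n 1 0 = 0 := by
      simpa using legendreSum_one_eq_zero (n := n) (k := 0) (by omega)
    rw [h1, h2, ih] at h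
    have : (0 : ℝ) < n := by exact_mod_cast hn
    push_cast
    field_simp at h ⊢
    linarith

lemma legendreSum_three_zero_bounds (n : ℕ) (hn : 1 ≤ n) :
    3 ≤ 2 * (n * (n + 1)) * legendreSum n 3 0 ∧
      2 * (n * (n + 1)) * legendreSum n 3 0 ≤ 3 * n := by
  induction n, hn using Nat.le_induction with
  | base =>
    norm_num [legendreSum, Finset.sum_range_succ, legendreCoeff]
  | succ n hn ih =>
    have h := legendreSum_succ_left n 2
    rw [legendreSum_two_zero n hn, legendreSum_two_zero (n + 1) (by omega)] at h
    have h0 : (1 : ℝ) ≤ n := by exact_mod_cast hn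
    -- The normalised quantity starts at 3 for n = 1 and grows by an amount in [0, 3] at each step.
    have e : 2 * (((n + 1 : ℕ) : ℝ) * ((n + 1 : ℕ) + 1)) * legendreSum (n + 1) 3 0
        = 2 * (n * (n + 1)) * legendreSum n 3 0 + 2 / n + 2 / (n + 2) := by
      push_cast at h ⊢
      calc _ = 2 * ((n : ℝ) + 1) * (((n : ℝ) + 2) * legendreSum (n + 1) (2 + 1) 0) := by ring
        _ = _ := by rw [h]; field_simp; ring
    rw [e]
    have h1 : (2 : ℝ) / n ≤ 2 := by rw [div_le_iff₀ (by linarith)]; linarith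
    have h2 : (2 : ℝ) / (n + 2) ≤ 1 := by rw [div_le_iff₀ (by linarith)]; linarith
    have h3 : (0 : ℝ) ≤ 2 / n := by positivity
    have h4 : (0 : ℝ) ≤ 2 / (n + 2) := by positivity
    push_cast
    constructor <;> linarith [ih.1, ih.2]

/-! ### Integrals of x^c log^m x on (0,1). -/

open Set Filter Topology in
lemma integrableOn_pow_mul_log_pow (c m : ℕ) :
    IntegrableOn (fun x : ℝ => x ^ c * Real.log x ^ m) (Ioo 0 1) := by
  -- |log x| ≤ 2(m+1) x^(-1/(2(m+1))) makes the m-th power at most a constant times x^(-1/2).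
  have hr : IntegrableOn (fun x : ℝ => (2 * ((m : ℝ) + 1)) ^ m * x ^ (-(1 / 2) : ℝ)) (Ioo 0 1) := by
    refine Integrable.const_mul ?_ _
    have := intervalIntegral.intervalIntegrable_rpow' (a := 0) (b := 1) (r := -(1 / 2))
      (by norm_num)
    rw [intervalIntegrable_iff_integrableOn_Ioo_of_le zero_le_one] at this
    exact this
  refine Integrable.mono' hr (by fun_prop) ?_
  refine (ae_restrict_iff' measurableSet_Ioo).mpr (ae_of_all _ fun x hx => ?_)
  have hx0 : 0 < x := hx.1
  have ht : (0 : ℝ) < 1 / (2 * (m + 1)) := by positivity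
  have h1 := (Real.abs_log_mul_self_rpow_lt x (1 / (2 * (m + 1))) hx0 hx.2.le ht).le
  rw [abs_mul, abs_of_pos (Real.rpow_pos_of_pos hx0 _), one_div_one_div] at h1
  have h2 : |Real.log x| ≤ 2 * (m + 1) * x ^ (-(1 / (2 * (m + 1))) : ℝ) := by
    rw [Real.rpow_neg hx0.le, ← div_eq_mul_inv, le_div_iff₀ (Real.rpow_pos_of_pos hx0 _)]
    exact h1
  have h3 : |Real.log x| ^ m ≤ (2 * (m + 1)) ^ m * x ^ (-(1 / 2) : ℝ) := by
    calc |Real.log x| ^ m ≤ (2 * (m + 1) * x ^ (-(1 / (2 * (m + 1))) : ℝ)) ^ m :=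
          pow_le_pow_left₀ (abs_nonneg _) h2 m
      _ = (2 * (m + 1)) ^ m * x ^ (-(1 / (2 * (m + 1))) * m : ℝ) := by
          rw [mul_pow, ← Real.rpow_natCast (x ^ _), ← Real.rpow_mul hx0.le]
      _ ≤ _ := by
          refine mul_le_mul_of_nonneg_left ?_ (by positivity)
          apply Real.rpow_le_rpow_of_exponent_ge hx0 hx.2.le
          have : (1 / (2 * ((m : ℝ) + 1))) * m ≤ 1 / 2 := by
            rw [div_mul_eq_mul_div, div_le_div_iff₀ (by positivity) (by norm_num)]; linarith
          linarith
  rw [Real.norm_eq_abs, abs_mul, abs_pow, abs_pow, abs_of_pos hx0]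
  calc x ^ c * |Real.log x| ^ m ≤ 1 * |Real.log x| ^ m :=
        mul_le_mul_of_nonneg_right (pow_le_one₀ hx0.le hx.2.le) (by positivity)
    _ ≤ _ := by rw [one_mul]; exact h3

/-- The value of `∫₀¹ x ^ c * log x ^ m` as a function of the exponents. -/
noncomputable def logMoment (m : ℕ) (c : ℝ) : ℝ :=
  (-1) ^ m * m.factorial / (c + 1) ^ (m + 1)

open Set Filter Topology in
lemma integral_pow_mul_log_pow (c m : ℕ) :
    ∫ x in Ioo (0 : ℝ) 1, x ^ c * Real.log x ^ m = logMoment m c := by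
  induction m with
  | zero =>
    rw [← integral_Ioc_eq_integral_Ioo, ← intervalIntegral.integral_of_le zero_le_one]
    simp [logMoment]
  | succ m ih =>
    have h1 := integrableOn_pow_mul_log_pow c m
    have h2 := integrableOn_pow_mul_log_pow c (m + 1)
    -- The primitive x^(c+1) log^(m+1) x tends to 0 at both ends, which relates the integrals for
    -- m+1 and m.
    have hF := intervalIntegral.integral_eq_sub_of_hasDerivAt_of_tendsto (a := 0) (b := 1)
      (f := fun x : ℝ => x ^ (c + 1) * Real.log x ^ (m + 1))
      (f' := fun x : ℝ => ((c : ℝ) + 1) * (x ^ c * Real.log x ^ (m + 1))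
        + ((m : ℝ) + 1) * (x ^ c * Real.log x ^ m)) (fa := 0) (fb := 0) zero_lt_one
      (fun x hx => by
        have := (hasDerivAt_pow (c + 1) x).mul ((Real.hasDerivAt_log hx.1.ne').pow (m + 1))
        convert! this using 1
        have := hx.1.ne'
        push_cast
        field_simp
        simp only [Pi.pow_apply]
        ring)
      (by
        rw [intervalIntegrable_iff_integrableOn_Ioo_of_le zero_le_one]
        exact (h2.const_mul _).add (h1.const_mul _))
      (by
        have h := tendsto_log_mul_rpow_nhdsGT_zero (r := 1 / (m + 1)) (by positivity)
        have h' := (h.pow (m + 1)).mul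
          ((tendsto_id (x := 𝓝 (0 : ℝ))).mono_left (nhdsWithin_le_nhds (s := Ioi 0)) |>.pow c)
        rw [zero_pow (Nat.succ_ne_zero m), zero_mul] at h'
        refine h'.congr' ?_
        filter_upwards [self_mem_nhdsWithin] with x hx
        rw [mul_pow, ← Real.rpow_natCast (x ^ _), ← Real.rpow_mul (le_of_lt hx)]
        have : (1 / ((m : ℝ) + 1)) * ((m + 1 : ℕ) : ℝ) = 1 := by push_cast; field_simp
        rw [this, Real.rpow_one, id]
        ring)
      (by
        have h : ContinuousAt (fun x : ℝ => x ^ (c + 1) * Real.log x ^ (m + 1)) 1 :=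
          (continuousAt_id.pow _).mul ((Real.continuousAt_log one_ne_zero).pow _)
        have h' := h.tendsto.mono_left (nhdsWithin_le_nhds (s := Iio 1))
        simpa using h')
    rw [intervalIntegral.integral_of_le zero_le_one, integral_Ioc_eq_integral_Ioo,
      integral_add (h2.const_mul _) (h1.const_mul _), integral_const_mul, integral_const_mul,
      ih] at hF
    have hc : (c : ℝ) + 1 ≠ 0 := by positivity
    have : ∫ x in Ioo (0 : ℝ) 1, x ^ c * Real.log x ^ (m + 1)
        = -((m : ℝ) + 1) * logMoment m c / (c + 1) := by
      field_simp; linarith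
    rw [this, logMoment, logMoment, Nat.factorial_succ]
    push_cast
    field_simp
    ring

/-! ### Cauchy-Schwarz bounds for the moments with k ≥ 1. -/

lemma integral_mul_sq_le {α : Type*} [MeasurableSpace α] {μ : Measure α} {f g : α → ℝ}
    (hff : Integrable (fun x => f x ^ 2) μ) (hfg : Integrable (fun x => f x * g x) μ)
    (hgg : Integrable (fun x => g x ^ 2) μ) (hpos : 0 < ∫ x, g x ^ 2 ∂μ) :
    (∫ x, f x * g x ∂μ) ^ 2 ≤ (∫ x, f x ^ 2 ∂μ) * ∫ x, g x ^ 2 ∂μ := by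
  set Q := ∫ x, g x ^ 2 ∂μ
  set R := ∫ x, f x * g x ∂μ
  have h : 0 ≤ ∫ x, (Q * f x - R * g x) ^ 2 ∂μ := integral_nonneg fun x => sq_nonneg _
  have e : ∫ x, (Q * f x - R * g x) ^ 2 ∂μ
      = Q ^ 2 * (∫ x, f x ^ 2 ∂μ) - 2 * Q * R * R + R ^ 2 * Q := by
    have e1 : ∀ x, (Q * f x - R * g x) ^ 2
        = Q ^ 2 * f x ^ 2 + -(2 * Q * R) * (f x * g x) + R ^ 2 * g x ^ 2 := fun x => by ring
    simp_rw [e1]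
    have hi : Integrable (fun x => Q ^ 2 * f x ^ 2 + -(2 * Q * R) * (f x * g x)) μ :=
      (hff.const_mul _).add (hfg.const_mul _)
    rw [integral_add hi (hgg.const_mul _),
      integral_add (hff.const_mul _) (hfg.const_mul _), integral_const_mul, integral_const_mul,
      integral_const_mul]
    ring
  rw [e] at h
  have : 0 ≤ Q * ((∫ x, f x ^ 2 ∂μ) * Q - R ^ 2) := by linarith
  linarith [nonneg_of_mul_nonneg_right this hpos]

open Set in
lemma integrableOn_sum_pow_mul_log_pow {ι : Type*} (s : Finset ι) (a : ι → ℝ) (c m : ι → ℕ) :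
    IntegrableOn (fun x : ℝ => ∑ i ∈ s, a i * (x ^ c i * Real.log x ^ m i)) (Ioo 0 1) :=
  integrable_finsetSum _ fun _ _ => (integrableOn_pow_mul_log_pow _ _).const_mul _

open Set in
lemma integral_sum_pow_mul_log_pow {ι : Type*} (s : Finset ι) (a : ι → ℝ) (c m : ι → ℕ) :
    ∫ x in Ioo (0 : ℝ) 1, ∑ i ∈ s, a i * (x ^ c i * Real.log x ^ m i)
      = ∑ i ∈ s, a i * logMoment (m i) (c i) := by
  rw [integral_finsetSum _ fun _ _ => (integrableOn_pow_mul_log_pow _ _).const_mul _]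
  simp_rw [integral_const_mul, integral_pow_mul_log_pow]

lemma sum_mul_sum_pow_mul_log_pow {ι κ : Type*} (s : Finset ι) (t : Finset κ) (a : ι → ℝ)
    (c m : ι → ℕ) (b : κ → ℝ) (d l : κ → ℕ) (x : ℝ) :
    (∑ i ∈ s, a i * (x ^ c i * Real.log x ^ m i)) * (∑ i ∈ t, b i * (x ^ d i * Real.log x ^ l i))
      = ∑ p ∈ s ×ˢ t, (a p.1 * b p.2) *
          (x ^ (c p.1 + d p.2) * Real.log x ^ (m p.1 + l p.2)) := by
  rw [Finset.sum_mul_sum, Finset.sum_product]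
  refine Finset.sum_congr rfl fun i _ => Finset.sum_congr rfl fun j _ => ?_
  rw [pow_add, pow_add]; ring

/-- Bessel's inequality for a combination of the functions `x ^ c * log x ^ m` against the
shifted Legendre polynomial. -/
lemma sum_legendreCoeff_mul_logMoment_sq_le {ι : Type*} (s : Finset ι) (a : ι → ℝ)
    (c m : ι → ℕ) (n : ℕ) :
    (∑ j ∈ Finset.range (n + 1), legendreCoeff n j *
        ∑ i ∈ s, a i * logMoment (m i) ((c i : ℝ) + j)) ^ 2
      ≤ (∑ i ∈ s, ∑ i' ∈ s, a i * a i' * logMoment (m i + m i') ((c i : ℝ) + c i'))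
          / (2 * n + 1) := by
  set f : ℝ → ℝ := fun x => ∑ i ∈ s, a i * (x ^ c i * Real.log x ^ m i) with hf
  set g : ℝ → ℝ := fun x => ∑ j ∈ Finset.range (n + 1),
    legendreCoeff n j * (x ^ j * Real.log x ^ 0) with hg
  have eff : ∀ x, f x ^ 2 = _ := fun x =>
    (sq (f x)).trans (sum_mul_sum_pow_mul_log_pow s s a c m a c m x)
  have egg : ∀ x, g x ^ 2 = _ := fun x => (sq (g x)).trans
    (sum_mul_sum_pow_mul_log_pow _ _ (legendreCoeff n) id 0 (legendreCoeff n) id 0 x)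
  have efg : ∀ x, f x * g x = _ := fun x =>
    sum_mul_sum_pow_mul_log_pow s _ a c m (legendreCoeff n) id 0 x
  have hG : ∫ x in Set.Ioo (0 : ℝ) 1, g x ^ 2 = 1 / (2 * n + 1) := by
    simp_rw [egg]
    rw [integral_sum_pow_mul_log_pow, Finset.sum_product, ← sum_sum_legendreCoeff_div]
    refine Finset.sum_congr rfl fun i _ => Finset.sum_congr rfl fun j _ => ?_
    simp [logMoment, div_eq_mul_inv]
  have hF : ∫ x in Set.Ioo (0 : ℝ) 1, f x ^ 2
      = ∑ i ∈ s, ∑ i' ∈ s, a i * a i' * logMoment (m i + m i') ((c i : ℝ) + c i') := by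
    simp_rw [eff]
    rw [integral_sum_pow_mul_log_pow, Finset.sum_product]
    push_cast
    rfl
  have hFG : ∫ x in Set.Ioo (0 : ℝ) 1, f x * g x
      = ∑ j ∈ Finset.range (n + 1), legendreCoeff n j *
        ∑ i ∈ s, a i * logMoment (m i) ((c i : ℝ) + j) := by
    simp_rw [efg]
    rw [integral_sum_pow_mul_log_pow, Finset.sum_product_right]
    refine Finset.sum_congr rfl fun j _ => ?_
    rw [Finset.mul_sum]
    refine Finset.sum_congr rfl fun i _ => ?_
    simp only [id, Pi.zero_apply, add_zero]
    push_cast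
    ring
  have key := integral_mul_sq_le (μ := volume.restrict (Set.Ioo (0 : ℝ) 1)) (f := f) (g := g)
    (by simp_rw [eff]; exact integrableOn_sum_pow_mul_log_pow _ _ _ _)
    (by simp_rw [efg]; exact integrableOn_sum_pow_mul_log_pow _ _ _ _)
    (by simp_rw [egg]; exact integrableOn_sum_pow_mul_log_pow _ _ _ _)
    (by rw [hG]; positivity)
  rw [hF, hG, hFG, mul_one_div] at key
  exact key

lemma sum_legendreCoeff_mul_logMoment (n i k : ℕ) :
    ∑ j ∈ Finset.range (n + 1), legendreCoeff n j * logMoment i ((k : ℝ) + j)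
      = (-1) ^ i * i.factorial * legendreSum n (i + 1) k := by
  rw [legendreSum, Finset.mul_sum]
  refine Finset.sum_congr rfl fun j _ => ?_
  rw [logMoment]; ring

/-- If a combination of the functions `x ^ c * log x ^ m` has the moments of the Legendre operator
applied to `x ^ (q + 1) * log x ^ i`, then its `L²` norm bounds the corresponding moment of the
Legendre polynomial. -/
lemma legendreSum_sq_le_of_adjoint {ι : Type*} (s : Finset ι) (a : ι → ℝ) (c m : ι → ℕ)
    (n i q : ℕ) {C : ℝ}
    (hadj : ∀ j : ℕ, ∑ l ∈ s, a l * logMoment (m l) ((c l : ℝ) + j)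
      = (j : ℝ) ^ 2 * logMoment i (q + j) - j * (j + 1) * logMoment i (q + 1 + j))
    (hC : ∑ l ∈ s, ∑ l' ∈ s, a l * a l' * logMoment (m l + m l') ((c l : ℝ) + c l') ≤ C) :
    (n * (n + 1) * (i.factorial * legendreSum n (i + 1) (q + 1))) ^ 2 ≤ C / (2 * n + 1) := by
  have h := sum_legendreCoeff_mul_logMoment_sq_le s a c m n
  have hsum := sum_legendreCoeff_mul_adjoint n (fun y => logMoment i (q + 1 + y))
  have e : ∑ j ∈ Finset.range (n + 1), legendreCoeff n j *
        ∑ l ∈ s, a l * logMoment (m l) ((c l : ℝ) + j)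
      = -(n * (n + 1) * ((-1) ^ i * i.factorial * legendreSum n (i + 1) (q + 1))) := by
    have h2 := sum_legendreCoeff_mul_logMoment n i (q + 1)
    push_cast at h2
    rw [← h2, eq_neg_iff_add_eq_zero, Finset.mul_sum, ← Finset.sum_add_distrib, ← hsum]
    refine Finset.sum_congr rfl fun j _ => ?_
    rw [hadj, show (q : ℝ) + 1 + (j - 1) = q + j by ring]
    ring
  rw [e] at h
  have e2 : (-(n * (n + 1) * ((-1 : ℝ) ^ i * i.factorial * legendreSum n (i + 1) (q + 1)))) ^ 2
      = (n * (n + 1) * (i.factorial * legendreSum n (i + 1) (q + 1))) ^ 2 := by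
    have : ((-1 : ℝ) ^ i) ^ 2 = 1 := by rw [← pow_mul, mul_comm, pow_mul]; simp
    calc _ = ((-1 : ℝ) ^ i) ^ 2 * (n * (n + 1) * (i.factorial * legendreSum n (i + 1) (q + 1))) ^ 2
        := by ring
      _ = _ := by rw [this, one_mul]
  rw [e2] at h
  exact h.trans (div_le_div_of_nonneg_right hC (by positivity))

/-- Here and in the three lemmas that follow, the vectors list the coefficients, powers of x and
powers of log x in L(x^k log^i x), with k = q+1 and i = 0, 1, 2, 3. The constant C bounds the
squared norm of that function, which decays like k^(1-2i). -/
lemma legendreSum_one_sq_le (n q : ℕ) :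
    (n * (n + 1) * legendreSum n 1 (q + 1)) ^ 2 ≤ (1 / 3 * ((q : ℝ) + 1)) / (2 * n + 1) := by
  have h := legendreSum_sq_le_of_adjoint (Finset.univ : Finset (Fin 2))
    ![((q : ℝ) + 1) ^ 2, -((q + 1) ^ 2 + (q + 1))] ![q, q + 1] ![0, 0] n 0 q
    (C := 1 / 3 * ((q : ℝ) + 1)) ?_ ?_
  · simpa using h
  · intro j
    have h1 : (q : ℝ) + j + 1 ≠ 0 := by positivity
    have h2 : (q : ℝ) + 1 + j + 1 ≠ 0 := by positivity
    simp [Fin.sum_univ_succ, logMoment]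
    field_simp
    ring
  · simp [Fin.sum_univ_succ, logMoment]
    -- Expanding in q rather than in k = q+1 leaves no negative coefficients, so positivity
    -- suffices.
    rw [← sub_nonneg]
    field_simp
    ring_nf
    positivity

lemma legendreSum_two_sq_le (n q : ℕ) :
    (n * (n + 1) * legendreSum n 2 (q + 1)) ^ 2 ≤ (1 / 2 / ((q : ℝ) + 1)) / (2 * n + 1) := by
  have h := legendreSum_sq_le_of_adjoint (Finset.univ : Finset (Fin 4))
    ![2 * ((q : ℝ) + 1), ((q : ℝ) + 1) ^ 2, -(2 * (q + 1) + 1), -((q + 1) ^ 2 + (q + 1))]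
    ![q, q, q + 1, q + 1] ![0, 1, 0, 1] n 1 q
    (C := 1 / 2 / ((q : ℝ) + 1)) ?_ ?_
  · simpa using h
  · intro j
    have h1 : (q : ℝ) + j + 1 ≠ 0 := by positivity
    have h2 : (q : ℝ) + 1 + j + 1 ≠ 0 := by positivity
    simp [Fin.sum_univ_succ, logMoment]
    field_simp
    ring
  · simp [Fin.sum_univ_succ, logMoment]
    rw [← sub_nonneg]
    field_simp
    ring_nf
    positivity

set_option maxHeartbeats 1000000 in
lemma legendreSum_three_sq_le (n q : ℕ) :
    (n * (n + 1) * (2 * legendreSum n 3 (q + 1))) ^ 2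
      ≤ (3.1 / ((q : ℝ) + 1) ^ 3) / (2 * n + 1) := by
  have h := legendreSum_sq_le_of_adjoint (Finset.univ : Finset (Fin 6))
    ![2, 4 * ((q : ℝ) + 1), ((q : ℝ) + 1) ^ 2,
      -2, -(4 * (q + 1) + 2), -((q + 1) ^ 2 + (q + 1))]
    ![q, q, q, q + 1, q + 1, q + 1] ![0, 1, 2, 0, 1, 2] n 2 q
    (C := 3.1 / ((q : ℝ) + 1) ^ 3) ?_ ?_
  · simpa using h
  · intro j
    have h1 : (q : ℝ) + j + 1 ≠ 0 := by positivity
    have h2 : (q : ℝ) + 1 + j + 1 ≠ 0 := by positivity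
    simp [Fin.sum_univ_succ, logMoment]
    field_simp
    ring
  · simp [Fin.sum_univ_succ, logMoment]
    rw [← sub_nonneg]
    field_simp
    ring_nf
    positivity

set_option maxHeartbeats 2000000 in
lemma legendreSum_four_sq_le (n q : ℕ) :
    (n * (n + 1) * (6 * legendreSum n 4 (q + 1))) ^ 2
      ≤ (75 / ((q : ℝ) + 1) ^ 5) / (2 * n + 1) := by
  have h := legendreSum_sq_le_of_adjoint (Finset.univ : Finset (Fin 6))
    ![6, 6 * ((q : ℝ) + 1), ((q : ℝ) + 1) ^ 2,
      -6, -(6 * (q + 1) + 3), -((q + 1) ^ 2 + (q + 1))]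
    ![q, q, q, q + 1, q + 1, q + 1] ![1, 2, 3, 1, 2, 3] n 3 q
    (C := 75 / ((q : ℝ) + 1) ^ 5) ?_ ?_
  · simpa [Nat.factorial] using h
  · intro j
    have h1 : (q : ℝ) + j + 1 ≠ 0 := by positivity
    have h2 : (q : ℝ) + 1 + j + 1 ≠ 0 := by positivity
    simp [Fin.sum_univ_succ, logMoment, Nat.factorial]
    field_simp
    ring
  · simp [Fin.sum_univ_succ, logMoment, Nat.factorial]
    rw [← sub_nonneg]
    field_simp
    ring_nf
    positivity

/-! ### Absolute convergence and the series for the double integral. -/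

lemma volume_restrict_unitSquare :
    (volume : Measure (ℝ × ℝ)).restrict unitSquare
      = (volume.restrict (Set.Ioo (0 : ℝ) 1)).prod (volume.restrict (Set.Ioo (0 : ℝ) 1)) := by
  rw [unitSquare, Measure.volume_eq_prod, Measure.prod_restrict]

lemma measurableSet_unitSquare : MeasurableSet unitSquare :=
  measurableSet_Ioo.prod measurableSet_Ioo

/-- On the square log(xy) = log x + log y; the cube expands into products of one-variable functions,
and the symmetry x ↔ y merges the four terms into two. -/
lemma integral_unitSquare_pow_mul_log_cubed (k : ℕ) (φ : ℝ → ℝ)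
    (hφ : ∀ i, IntegrableOn (fun x => x ^ k * Real.log x ^ i * φ x) (Set.Ioo 0 1)) :
    IntegrableOn (fun p : ℝ × ℝ => (p.1 * p.2) ^ k * Real.log (p.1 * p.2) ^ 3 * (φ p.1 * φ p.2))
        unitSquare ∧
      ∫ p in unitSquare, (p.1 * p.2) ^ k * Real.log (p.1 * p.2) ^ 3 * (φ p.1 * φ p.2)
        = 2 * (∫ x in Set.Ioo 0 1, x ^ k * Real.log x ^ 0 * φ x)
            * (∫ x in Set.Ioo 0 1, x ^ k * Real.log x ^ 3 * φ x)
          + 6 * (∫ x in Set.Ioo 0 1, x ^ k * Real.log x ^ 1 * φ x)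
            * (∫ x in Set.Ioo 0 1, x ^ k * Real.log x ^ 2 * φ x) := by
  set e : ℕ → ℝ → ℝ := fun i x => x ^ k * Real.log x ^ i * φ x with he
  set μ := volume.restrict (Set.Ioo (0 : ℝ) 1)
  have hi : ∀ i j, Integrable (fun p : ℝ × ℝ => e i p.1 * e j p.2) (μ.prod μ) :=
    fun i j => (hφ i).mul_prod (hφ j)
  have hv : ∀ i j, ∫ p : ℝ × ℝ, e i p.1 * e j p.2 ∂(μ.prod μ)
      = (∫ x, e i x ∂μ) * ∫ x, e j x ∂μ := fun i j => integral_prod_mul _ _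
  have hae : (fun p : ℝ × ℝ => (p.1 * p.2) ^ k * Real.log (p.1 * p.2) ^ 3 * (φ p.1 * φ p.2))
      =ᵐ[volume.restrict unitSquare] fun p => (e 0 p.1 * e 3 p.2 + e 3 p.1 * e 0 p.2)
        + (3 * (e 1 p.1 * e 2 p.2) + 3 * (e 2 p.1 * e 1 p.2)) := by
    refine (ae_restrict_iff' measurableSet_unitSquare).mpr (ae_of_all _ fun p hp => ?_)
    simp only [he]
    rw [Real.log_mul hp.1.1.ne' hp.2.1.ne']
    ring
  have h1 : Integrable (fun p : ℝ × ℝ => e 0 p.1 * e 3 p.2 + e 3 p.1 * e 0 p.2) (μ.prod μ) :=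
    (hi 0 3).add (hi 3 0)
  have h2 : Integrable (fun p : ℝ × ℝ => 3 * (e 1 p.1 * e 2 p.2) + 3 * (e 2 p.1 * e 1 p.2))
      (μ.prod μ) := ((hi 1 2).const_mul 3).add ((hi 2 1).const_mul 3)
  constructor
  · refine Integrable.congr ?_ hae.symm
    rw [volume_restrict_unitSquare]
    exact h1.add h2
  · rw [integral_congr_ae hae, volume_restrict_unitSquare, integral_add h1 h2,
      integral_add (hi 0 3) (hi 3 0),
      integral_add ((hi 1 2).const_mul 3) ((hi 2 1).const_mul 3), integral_const_mul,
      integral_const_mul, hv, hv, hv, hv]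
    ring

lemma continuous_legendreP (n : ℕ) : Continuous (legendreP n) := by
  rw [funext (legendreP_eq_sum n)]
  fun_prop

lemma abs_legendreP_le (n : ℕ) {x : ℝ} (hx : x ∈ Set.Ioo (0 : ℝ) 1) :
    |legendreP n x| ≤ ∑ j ∈ Finset.range (n + 1), |legendreCoeff n j| := by
  rw [legendreP_eq_sum]
  refine (Finset.abs_sum_le_sum_abs _ _).trans (Finset.sum_le_sum fun j _ => ?_)
  rw [abs_mul, abs_pow, abs_of_pos hx.1]
  exact mul_le_of_le_one_right (abs_nonneg _) (pow_le_one₀ hx.1.le hx.2.le)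

lemma pow_mul_log_pow_mul_legendreP (n k i : ℕ) (x : ℝ) :
    x ^ k * Real.log x ^ i * legendreP n x = ∑ j ∈ Finset.range (n + 1),
      legendreCoeff n j * (x ^ (k + j) * Real.log x ^ i) := by
  rw [legendreP_eq_sum, Finset.mul_sum]
  refine Finset.sum_congr rfl fun j _ => ?_
  rw [pow_add]; ring

lemma integrableOn_pow_mul_log_pow_mul_legendreP (n k i : ℕ) :
    IntegrableOn (fun x => x ^ k * Real.log x ^ i * legendreP n x) (Set.Ioo 0 1) := by
  simp_rw [pow_mul_log_pow_mul_legendreP]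
  exact integrableOn_sum_pow_mul_log_pow _ _ _ _

lemma integral_pow_mul_log_pow_mul_legendreP (n k i : ℕ) :
    ∫ x in Set.Ioo (0 : ℝ) 1, x ^ k * Real.log x ^ i * legendreP n x
      = (-1) ^ i * i.factorial * legendreSum n (i + 1) k := by
  simp_rw [pow_mul_log_pow_mul_legendreP]
  rw [integral_sum_pow_mul_log_pow, ← sum_legendreCoeff_mul_logMoment]
  push_cast
  rfl

/-- The inequality e^t ≥ 1 + t at t = -log a gives |log a|/(1-a) ≤ 1 + |log a|, which removes the
singularity at a = 1. -/
lemma abs_log_cubed_div_le {a : ℝ} (h0 : 0 < a) (h1 : a < 1) :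
    |Real.log a ^ 3 / (1 - a)| ≤ |Real.log a| ^ 2 + |Real.log a| ^ 3 := by
  have hl : Real.log a < 0 := Real.log_neg h0 h1
  have h2 : 0 < 1 - a := by linarith
  have h3 : -Real.log a ≤ (1 - Real.log a) * (1 - a) := by
    have h4 : 1 - Real.log a ≤ a⁻¹ := by
      have := Real.add_one_le_exp (-Real.log a)
      rw [Real.exp_neg, Real.exp_log h0] at this
      linarith
    have h5 : (1 - Real.log a) * a ≤ 1 := by
      calc _ ≤ a⁻¹ * a := mul_le_mul_of_nonneg_right h4 h0.le
        _ = 1 := inv_mul_cancel₀ h0.ne'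
    linarith
  rw [abs_div, abs_of_pos h2, abs_pow, abs_of_neg hl, div_le_iff₀ h2]
  have := mul_le_mul_of_nonneg_left h3 (sq_nonneg (-Real.log a))
  linarith

lemma mul_mem_Ioo_of_mem_unitSquare {p : ℝ × ℝ} (hp : p ∈ unitSquare) :
    0 < p.1 * p.2 ∧ p.1 * p.2 < 1 :=
  ⟨mul_pos hp.1.1 hp.2.1, mul_lt_one_of_nonneg_of_lt_one_left hp.1.1.le hp.1.2 hp.2.2.le⟩

lemma integrableOn_unitSquare_log_pow (i : ℕ) :
    IntegrableOn (fun p : ℝ × ℝ => |Real.log (p.1 * p.2)| ^ i) unitSquare := by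
  have h : IntegrableOn (fun p : ℝ × ℝ => Real.log (p.1 * p.2) ^ i) unitSquare := by
    have hae : (fun p : ℝ × ℝ => Real.log (p.1 * p.2) ^ i) =ᵐ[volume.restrict unitSquare]
        fun p => ∑ m ∈ Finset.range (i + 1),
          Real.log p.1 ^ m * Real.log p.2 ^ (i - m) * (i.choose m : ℝ) := by
      refine (ae_restrict_iff' measurableSet_unitSquare).mpr (ae_of_all _ fun p hp => ?_)
      simp only
      rw [Real.log_mul hp.1.1.ne' hp.2.1.ne', add_pow]
    have hl : ∀ m, Integrable (fun x => Real.log x ^ m) (volume.restrict (Set.Ioo (0 : ℝ) 1)) :=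
      fun m => by simpa [IntegrableOn] using integrableOn_pow_mul_log_pow 0 m
    refine Integrable.congr ?_ hae.symm
    rw [volume_restrict_unitSquare]
    exact integrable_finsetSum _ fun m _ => ((hl m).mul_prod (hl (i - m))).mul_const _
  simpa [IntegrableOn, abs_pow] using h.abs

lemma integrableOn_integrandJ3 (n : ℕ) : IntegrableOn (integrandJ3 n) unitSquare := by
  set B := ∑ j ∈ Finset.range (n + 1), |legendreCoeff n j|
  have hB : 0 ≤ B := Finset.sum_nonneg fun _ _ => abs_nonneg _
  have hdom := ((integrableOn_unitSquare_log_pow 2).add (integrableOn_unitSquare_log_pow 3)).const_mul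
    (B * B)
  refine Integrable.mono' hdom ?_ ?_
  · have hP : Measurable (legendreP n) := (continuous_legendreP n).measurable
    have : Measurable (integrandJ3 n) := by
      unfold integrandJ3
      fun_prop
    exact this.aestronglyMeasurable
  · refine (ae_restrict_iff' measurableSet_unitSquare).mpr (ae_of_all _ fun p hp => ?_)
    have ha := mul_mem_Ioo_of_mem_unitSquare hp
    have e : integrandJ3 n p = legendreP n p.1 * legendreP n p.2
        * (Real.log (p.1 * p.2) ^ 3 / (1 - p.1 * p.2)) := by
      rw [integrandJ3]; ring
    rw [Real.norm_eq_abs, e, abs_mul, abs_mul]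
    exact mul_le_mul (mul_le_mul (abs_legendreP_le n hp.1) (abs_legendreP_le n hp.2)
      (abs_nonneg _) hB) (abs_log_cubed_div_le ha.1 ha.2) (abs_nonneg _) (by positivity)

/-- The series expansion of the integral in the moments of the Legendre polynomial. -/
lemma hasSum_J3 (n : ℕ) :
    HasSum (fun k : ℕ => 12 * (legendreSum n 1 k * legendreSum n 4 k
      + legendreSum n 2 k * legendreSum n 3 k)) (J3 n) := by
  set F : ℕ → ℝ × ℝ → ℝ := fun k p =>
    (p.1 * p.2) ^ k * Real.log (p.1 * p.2) ^ 3 * (legendreP n p.1 * legendreP n p.2) with hF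
  have hint := fun k => integral_unitSquare_pow_mul_log_cubed k (legendreP n)
    (integrableOn_pow_mul_log_pow_mul_legendreP n k)
  have hone := fun k : ℕ => integral_unitSquare_pow_mul_log_cubed k (fun _ => 1)
    (fun i => by simpa using integrableOn_pow_mul_log_pow k i)
  set B := ∑ j ∈ Finset.range (n + 1), |legendreCoeff n j|
  have hB : 0 ≤ B := Finset.sum_nonneg fun _ _ => abs_nonneg _
  -- P_n is bounded by B on (0,1), and replacing it by 1 makes the integral exactly 24/(k+1)^5; this
  -- summable bound justifies exchanging sum and integral.
  have hbound : ∀ k, ∫ p in unitSquare, ‖F k p‖ ≤ B * B * (24 / ((k : ℝ) + 1) ^ 5) := by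
    intro k
    have hv : ∫ p in unitSquare, -((p.1 * p.2) ^ k * Real.log (p.1 * p.2) ^ 3 * (1 * 1))
        = 24 / ((k : ℝ) + 1) ^ 5 := by
      rw [integral_neg, (hone k).2]
      simp only [mul_one, integral_pow_mul_log_pow, logMoment, Nat.factorial]
      have : (k : ℝ) + 1 ≠ 0 := by positivity
      push_cast
      field_simp
      ring
    rw [← hv, ← integral_const_mul]
    refine setIntegral_mono_on (hint k).1.norm ((hone k).1.neg.const_mul _)
      measurableSet_unitSquare fun p hp => ?_
    have ha := mul_mem_Ioo_of_mem_unitSquare hp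
    have hl : Real.log (p.1 * p.2) < 0 := Real.log_neg ha.1 ha.2
    have h3 : |Real.log (p.1 * p.2) ^ 3| = -(Real.log (p.1 * p.2) ^ 3) := by
      rw [abs_of_nonpos]
      exact (Odd.pow_neg (by decide) hl).le
    rw [Real.norm_eq_abs, abs_mul, abs_mul, abs_mul, h3, abs_of_pos (pow_pos ha.1 k)]
    have hPP : |legendreP n p.1| * |legendreP n p.2| ≤ B * B :=
      mul_le_mul (abs_legendreP_le n hp.1) (abs_legendreP_le n hp.2) (abs_nonneg _) hB
    have hnn : 0 ≤ (p.1 * p.2) ^ k * -(Real.log (p.1 * p.2) ^ 3) := by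
      rw [← h3]; exact mul_nonneg (pow_pos ha.1 k).le (abs_nonneg _)
    calc _ ≤ (p.1 * p.2) ^ k * -(Real.log (p.1 * p.2) ^ 3) * (B * B) :=
          mul_le_mul_of_nonneg_left hPP hnn
      _ = _ := by ring
  have hsummable : Summable fun k => ∫ p in unitSquare, ‖F k p‖ := by
    refine Summable.of_nonneg_of_le (fun k => integral_nonneg fun p => norm_nonneg _) hbound ?_
    refine Summable.mul_left _ ?_
    have := ((summable_nat_add_iff 1).mpr
      (Real.summable_one_div_nat_pow.mpr (by norm_num : 1 < 5))).mul_left (24 : ℝ)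
    refine this.congr fun k => ?_
    push_cast
    ring
  have h := hasSum_integral_of_summable_integral_norm (fun k => (hint k).1) hsummable
  have hlim : ∫ p in unitSquare, ∑' k, F k p = ∫ p in unitSquare, integrandJ3 n p := by
    refine setIntegral_congr_fun measurableSet_unitSquare fun p hp => ?_
    have ha := mul_mem_Ioo_of_mem_unitSquare hp
    simp only [hF]
    simp_rw [mul_assoc]
    rw [tsum_mul_right, tsum_geometric_of_lt_one ha.1.le ha.2, integrandJ3]
    ring
  rw [hlim] at h
  have h' := h.neg
  rw [← J3] at h'
  have e : (fun k : ℕ => 12 * (legendreSum n 1 k * legendreSum n 4 k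
      + legendreSum n 2 k * legendreSum n 3 k)) = fun k => -∫ p in unitSquare, F k p := by
    ext k
    rw [(hint k).2]
    simp only [integral_pow_mul_log_pow_mul_legendreP, Nat.factorial]
    push_cast
    ring
  rw [e]
  exact h'

/-! ### The tail estimate and the conclusion. -/

lemma abs_legendreSum_term_succ_le (n q : ℕ) (hn : 1 ≤ n) :
    |12 * (legendreSum n 1 (q + 1) * legendreSum n 4 (q + 1)
        + legendreSum n 2 (q + 1) * legendreSum n 3 (q + 1))|
      ≤ 35 / 6 / ((n : ℝ) * (n + 1)) ^ 2 * (1 / ((q : ℝ) + 1) ^ 2) := by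
  have hn' : (1 : ℝ) ≤ n := by exact_mod_cast hn
  set N : ℝ := n * (n + 1) with hN
  have hNpos : 0 < N := by positivity
  set k : ℝ := q + 1 with hk
  have hkpos : 0 < k := by positivity
  -- Since n ≥ 1, the squared norm 1/(2n+1) of P_n is at most 1/3.
  have hthird : ∀ {a C : ℝ}, 0 ≤ C → a ≤ C / (2 * n + 1) → a ≤ C / 3 := fun hC h =>
    h.trans (div_le_div_of_nonneg_left hC (by norm_num) (by linarith))
  have b1 := hthird (by positivity) (legendreSum_one_sq_le n q)
  have b2 := hthird (by positivity) (legendreSum_two_sq_le n q)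
  have b3 := hthird (by positivity) (legendreSum_three_sq_le n q)
  have b4 := hthird (by positivity) (legendreSum_four_sq_le n q)
  rw [← hN, ← hk] at b1 b2 b3 b4
  -- (1/3) · 75 / 9 = (5/3)², and the powers of k combine to k^(-4) before the square root.
  have c1 : |(N * legendreSum n 1 k) * (N * (6 * legendreSum n 4 k))| ≤ 5 / 3 / k ^ 2 := by
    refine abs_le_of_sq_le_sq ?_ (by positivity)
    rw [mul_pow]
    refine (mul_le_mul b1 b4 (sq_nonneg _) (by positivity)).trans (le_of_eq ?_)
    field_simp
    norm_num
  -- (1/2) · 3.1 / 9 is just below (5/12)².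
  have c2 : |(N * legendreSum n 2 k) * (N * (2 * legendreSum n 3 k))| ≤ 5 / 12 / k ^ 2 := by
    refine abs_le_of_sq_le_sq ?_ (by positivity)
    rw [mul_pow]
    refine (mul_le_mul b2 b3 (sq_nonneg _) (by positivity)).trans ?_
    rw [← sub_nonneg]
    field_simp
    norm_num
  have e : 12 * (legendreSum n 1 k * legendreSum n 4 k + legendreSum n 2 k * legendreSum n 3 k)
      = (2 * ((N * legendreSum n 1 k) * (N * (6 * legendreSum n 4 k)))
        + 6 * ((N * legendreSum n 2 k) * (N * (2 * legendreSum n 3 k)))) / N ^ 2 := by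
    field_simp
    ring
  have e2 : 35 / 6 / N ^ 2 * (1 / k ^ 2) = (2 * (5 / 3 / k ^ 2) + 6 * (5 / 12 / k ^ 2)) / N ^ 2 := by
    field_simp
    norm_num
  rw [e, e2, abs_div, abs_of_pos (by positivity : (0 : ℝ) < N ^ 2)]
  refine div_le_div_of_nonneg_right ?_ (by positivity)
  refine (abs_add_le _ _).trans ?_
  rw [abs_mul, abs_mul 6, abs_of_pos (by norm_num : (0 : ℝ) < 2),
    abs_of_pos (by norm_num : (0 : ℝ) < 6)]
  linarith

lemma abs_J3_sub_le (n : ℕ) (hn : 1 ≤ n) :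
    |J3 n - 12 * (legendreSum n 2 0 * legendreSum n 3 0)| ≤ 10 / ((n : ℝ) * (n + 1)) ^ 2 := by
  have h := (hasSum_nat_add_iff' 1).mpr (hasSum_J3 n)
  have h0 : legendreSum n 1 0 = 0 := by
    simpa using legendreSum_one_eq_zero (n := n) (k := 0) hn
  simp only [Finset.sum_range_one, Nat.cast_zero, h0, zero_mul, zero_add] at h
  -- The zeta series starts at index 0 with 1/0² = 0, so dropping that term changes nothing.
  have hz : HasSum (fun q : ℕ => 1 / ((q : ℝ) + 1) ^ 2) (Real.pi ^ 2 / 6) := by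
    have := (hasSum_nat_add_iff' 1).mpr hasSum_zeta_two
    simpa using this
  have hz' := hz.mul_left (35 / 6 / ((n : ℝ) * (n + 1)) ^ 2)
  have hb : ∀ q : ℕ, _ := fun q => abs_legendreSum_term_succ_le n q hn
  have hn' : (1 : ℝ) ≤ n := by exact_mod_cast hn
  -- 35π²/36 is about 9.6.
  have hle : 35 / 6 / ((n : ℝ) * (n + 1)) ^ 2 * (Real.pi ^ 2 / 6)
      ≤ 10 / ((n : ℝ) * (n + 1)) ^ 2 := by
    rw [div_mul_eq_mul_div]
    refine div_le_div_of_nonneg_right ?_ (by positivity)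
    nlinarith [Real.pi_lt_d2, Real.pi_pos]
  push_cast at h
  rw [abs_le]
  constructor
  · have := hasSum_le (fun q => (abs_le.mp (hb q)).1) hz'.neg h
    linarith
  · have := hasSum_le (fun q => (abs_le.mp (hb q)).2) h hz'
    linarith

theorem mainTheorem4 (n : ℕ) (hn : 1 ≤ n) :
    IntegrableOn (integrandJ3 n) unitSquare (volume : Measure (ℝ × ℝ)) ∧
      6 / ((n : ℝ) + 1) ^ 4 ≤ J3 n ∧
      J3 n ≤ 6 * Real.pi ^ 2 / ((n : ℝ) + 1 / 2) ^ 2 := by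
  have hn' : (1 : ℝ) ≤ n := by exact_mod_cast hn
  have hJ := abs_le.mp (abs_J3_sub_le n hn)
  have h3 := legendreSum_three_zero_bounds n hn
  rw [legendreSum_two_zero n hn] at hJ
  have e : 12 * (1 / ((n : ℝ) * (n + 1)) * legendreSum n 3 0)
      = 6 * (2 * (n * (n + 1)) * legendreSum n 3 0) / ((n : ℝ) * (n + 1)) ^ 2 := by
    field_simp
    ring
  rw [e] at hJ
  refine ⟨integrableOn_integrandJ3 n, ?_, ?_⟩
  · calc 6 / ((n : ℝ) + 1) ^ 4 ≤ 8 / ((n : ℝ) * (n + 1)) ^ 2 := by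
          refine div_le_div₀ (by norm_num) (by norm_num) (by positivity) ?_
          have : (n : ℝ) * (n + 1) ≤ (n + 1) ^ 2 := by nlinarith
          calc ((n : ℝ) * (n + 1)) ^ 2 ≤ ((n + 1) ^ 2) ^ 2 :=
                pow_le_pow_left₀ (by positivity) this 2
            _ = _ := by ring
      _ = 6 * 3 / ((n : ℝ) * (n + 1)) ^ 2 - 10 / ((n : ℝ) * (n + 1)) ^ 2 := by ring
      _ ≤ 6 * (2 * (n * (n + 1)) * legendreSum n 3 0) / ((n : ℝ) * (n + 1)) ^ 2
          - 10 / ((n : ℝ) * (n + 1)) ^ 2 := by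
          gcongr
          exact h3.1
      _ ≤ J3 n := by linarith [hJ.1]
  · calc J3 n ≤ 6 * (2 * (n * (n + 1)) * legendreSum n 3 0) / ((n : ℝ) * (n + 1)) ^ 2
          + 10 / ((n : ℝ) * (n + 1)) ^ 2 := by linarith [hJ.2]
      _ ≤ 6 * (3 * n) / ((n : ℝ) * (n + 1)) ^ 2 + 10 / ((n : ℝ) * (n + 1)) ^ 2 := by
          refine add_le_add_left (div_le_div_of_nonneg_right ?_ (by positivity)) _
          linarith [h3.2]
      -- 18n + 10 ≤ 28n(n+1) for n ≥ 1.
      _ ≤ 28 / (n * (n + 1)) := by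
          rw [← add_div, div_le_div_iff₀ (by positivity) (by positivity)]
          nlinarith [mul_pos (by positivity : (0 : ℝ) < n) (by positivity : (0 : ℝ) < (n : ℝ) + 1)]
      -- 54 = 6 · 3² is what π > 3 leaves of 6π².
      _ ≤ 54 / ((n : ℝ) + 1 / 2) ^ 2 := by
          rw [div_le_div_iff₀ (by positivity) (by positivity)]
          nlinarith
      _ ≤ _ := by
          gcongr
          nlinarith [Real.pi_gt_three]
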